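/- **Lemma (Iteration complexity of DREEM).** Setting. Let $\mathcal S$ be a (measurable) state space, $\mathcal A$ a finite non-empty action set with uniform distribution $U$, $H$ the horizon, $M^\star$ the true transition model, and fix an initial state distribution. For a model $M$ (transition probabilities $P_M(\cdot\mid s,a)$) and a policy $\pi$, let $P_M^{\pi,h}$ be the law of the state at time step $h$ when starting from the initial distribution, choosing actions by $\pi$ and moving by $M$. With $\|\mu-\nu\|_{TV}$ denoting the total variation ($\ell^1$) norm $\sum_s|\mu(s)-\nu(s)|$ (for general measures, the total mass of $|\mu-\nu|$), put for $1\le h\le H$ $$\mathcal W(\pi,M,h)=\mathbb E_{s\sim P_{M^\star}^{\pi,h-1},\,a\sim U}\big\|P_M(\cdot\mid s,a)-P_{M^\star}(\cdot\mid s,a)\big\|_{TV},$$ let $\mathcal D(\pi,M,M',h)$ be the $\ell^1$ distance between the laws of $(s,a,s')$ with $s\sim P_M^{\pi,h-1}$, $a\sim U$, $s'\sim P_M(\cdot\mid s,a)$ and the same with $M'$ in place of $M$, and for a set $\mathcal N$ of models let $v_{\rm explore}(\pi,\mathcal N)=\sup_{M,M'\in\mathcal N}\sum_{h=1}^H\mathcal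 D(\pi,M,M',h)$. Algorithm. Given a set $\mathcal M$ of models with $M^\star\in\mathcal M$, a policy class $\Pi$, $n\in\mathbb N$, $\epsilon>0$ and $\phi$, DREEM sets $\mathcal M_1=\mathcal M$ and in round $t=1,2,\dots$ takes an exact maximizer $\pi^t\in\Pi$ of $v_{\rm explore}(\cdot,\mathcal M_t)$. If $v_{\rm explore}(\pi^t,\mathcal M_t)\le\epsilon/|\mathcal A|$ it halts in this round. Otherwise it collects, for each $h\le H$, $n$ transitions $(s^{(i)}_{h-1},a^{(i)}_{h-1},s^{(i)}_h)$ with $\pi^t$, computes from them the empirical misfits $$\widetilde{\mathcal W}(\pi^t,M,h)=\sup_{f\in\widetilde{\mathcal F}}\frac1n\sum_{i=1}^n\Big[\mathbb E_{s'\sim P_M(\cdot\mid s^{(i)}_{h-1},a^{(i)}_{h-1})}f(s^{(i)}_{h-1},a^{(i)}_{h-1},s')-f(s^{(i)}_{h-1},a^{(i)}_{h-1},s^{(i)}_h)\Big]$$ for a given class $\widetilde{\mathcal F}$ of test functions, and sets $\mathcal M_{t+1}=\{M\in\mathcal M_t:\widetilde{\mathcal W}(\pi^t,M,h)\le\phi\text{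 for all }1\le h\le H\}$. Rank. For a real matrix $B$ let $\mathrm{rank}(B,\beta)$ be the smallest $k$ such that $B=UV^\top$ with $U,V$ having $k$ columns and $\|u_i\|_2\|v_j\|_2\le\beta$ for all rows $u_i$ of $U$ and $v_j$ of $V$. Let $A_h=(\mathcal W(\pi,M,h))_{\pi\in\Pi,M\in\mathcal M}$, let $\beta$ be such that $\mathrm{rank}(A_h,\beta)$ is defined for all $1\le h\le H$, and put $$d=\max_{1\le h\le H}\mathrm{rank}(A_h,\beta),\qquad \phi=\frac{\epsilon}{24H^2|\mathcal A|^2\sqrt d}.$$ Claim. Suppose that $|\widetilde{\mathcal W}(\pi^t,M,h)-\mathcal W(\pi^t,M,h)|\le\phi$ for every round $t$ in which data is collected, every $1\le h\le H$ and every $M\in\mathcal M$. Then DREEM halts, and the number of its rounds (the one in which it halts included) is at most $$\max\Big\{1,\ \frac{Hd\,\log(\beta/(2\phi))}{\log(5/3)}\Big\}.$$ (If $d=0$, where $\phi$ is not defined by the formula, it halts in the first round.) -/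

import Mathlib

open MeasureTheory ProbabilityTheory
open scoped ENNReal

noncomputable section

namespace DREEM

/-- A transition model: to each state-action pair a probability distribution over next states. -/
structure Model (S A : Type*) [MeasurableSpace S] [MeasurableSpace A] where
  kernel : Kernel (S × A) S
  markov : IsMarkovKernel kernel

attribute [instance] Model.markov

/-- A (randomized, possibly time-dependent) policy: at time step `h`, in state `s`, the action is
drawn from `kernel h s`. A stationary policy is one with `kernel` constant in `h`. -/
structure Policy (S A : Type*) [MeasurableSpace S] [MeasurableSpace A] where
  kernel : ℕ → Kernel S A
  markov : ∀ h, IsMarkovKernel (kernel h)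

attribute [instance] Policy.markov

/-- The environment: the distribution of the initial state `s₀`, the true transition model and the
horizon. (Rewards only affect which policy is returned after halting.) -/
structure Env (S A : Type*) [MeasurableSpace S] [MeasurableSpace A] where
  init : Measure S
  init_prob : IsProbabilityMeasure init
  truth : Model S A
  horizon : ℕ

attribute [instance] Env.init_prob

/-- The total variation norm `‖μ - ν‖` of the difference of two finite measures, normalized as the
`ℓ¹` norm: for discrete measures it is `∑ s, |μ s - ν s|`. -/
def tvNorm {X : Type*} [MeasurableSpace X] (μ ν : Measure X)
    [IsFiniteMeasure μ] [IsFiniteMeasure ν] : ℝ≥0∞ :=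
  (μ.toSignedMeasure - ν.toSignedMeasure).totalVariation Set.univ

section

variable {S A : Type*} [MeasurableSpace S] [MeasurableSpace A]

/-- The distribution of the state at time step `h` when actions are drawn from `π` and transitions
from `M`. -/
def stateDist (E : Env S A) (M : Model S A) (π : Policy S A) : ℕ → Measure S
  | 0 => E.init
  | h + 1 => (stateDist E M π h ⊗ₘ π.kernel h).bind M.kernel

instance stateDist_prob (E : Env S A) (M : Model S A) (π : Policy S A) (h : ℕ) :
    IsProbabilityMeasure (stateDist E M π h) := by
  induction h with
  | zero => exact E.init_prob
  | succ h ih => rw [stateDist]; infer_instance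

/-- The empirical misfit of `M`, computed from a dataset of `n` transitions
`((s_{h-1}, a_{h-1}), s_h)` with a class `F` of test functions: the supremum over `f ∈ F` of the
average of `E_{s' ∼ P_M(· | s_{h-1}, a_{h-1})} f (s_{h-1}, a_{h-1}, s') - f (s_{h-1}, a_{h-1}, s_h)`
over the dataset. -/
def empiricalMisfit {n : ℕ} (F : Set ((S × A) × S → ℝ)) (D : Fin n → (S × A) × S)
    (M : Model S A) : ℝ :=
  sSup ((fun f : (S × A) × S → ℝ =>
    (∑ i, ((∫ s', f ((D i).1, s') ∂(M.kernel (D i).1)) - f (D i))) / (n : ℝ)) '' F)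

variable [Fintype A] [Nonempty A]

/-- The law of `(s_{h-1}, a_{h-1})` when the first `h - 1` steps follow `π` in model `M` and the
last action is uniform. Only used for `h ≥ 1`. -/
def rollIn (E : Env S A) (M : Model S A) (π : Policy S A) (h : ℕ) : Measure (S × A) :=
  (stateDist E M π (h - 1)).prod (PMF.uniformOfFintype A).toMeasure

instance rollIn_prob (E : Env S A) (M : Model S A) (π : Policy S A) (h : ℕ) :
    IsProbabilityMeasure (rollIn E M π h) := by
  unfold rollIn; infer_instance

/-- The misfit of model `M` discovered by policy `π` at time step `h`. -/
def misfit (E : Env S A) (π : Policy S A) (M : Model S A) (h : ℕ) : ℝ :=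
  (∫⁻ x, tvNorm (M.kernel x) (E.truth.kernel x) ∂(rollIn E E.truth π h)).toReal

/-- The disagreement between `M` and `M'` induced by `π` at time step `h`: the `ℓ¹` distance of the
two laws of `(s_{h-1}, a_{h-1}, s_h)`, the last action being uniform. -/
def disagreement (E : Env S A) (π : Policy S A) (M M' : Model S A) (h : ℕ) : ℝ≥0∞ :=
  tvNorm (rollIn E M π h ⊗ₘ M.kernel) (rollIn E M' π h ⊗ₘ M'.kernel)

/-- The exploration value of `π` for a set of models. -/
def vExplore (E : Env S A) (π : Policy S A) (𝓜 : Set (Model S A)) : ℝ≥0∞ :=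
  ⨆ M ∈ 𝓜, ⨆ M' ∈ 𝓜, ∑ h ∈ Finset.Icc 1 E.horizon, disagreement E π M M' h

/-- The model misfit matrix `A_h`. -/
def misfitMatrix (E : Env S A) (Pi : Set (Policy S A)) (𝓜 : Set (Model S A)) (h : ℕ) :
    Matrix Pi 𝓜 ℝ :=
  fun π M => misfit E π M h

end

/-- `B = U Vᵀ` with `k` columns in `U` and `V`, and `‖uᵢ‖₂ ‖vⱼ‖₂ ≤ β` for all rows `uᵢ`, `vⱼ`. -/
def HasFactorization {m n : Type*} (B : Matrix m n ℝ) (β : ℝ) (k : ℕ) : Prop :=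
  ∃ (U : m → EuclideanSpace ℝ (Fin k)) (V : n → EuclideanSpace ℝ (Fin k)),
    (∀ i j, B i j = inner ℝ (U i) (V j)) ∧ ∀ i j, ‖U i‖ * ‖V j‖ ≤ β

/-- `rank(B, β)`: the smallest inner dimension of such a factorization. -/
def boundedRank {m n : Type*} (B : Matrix m n ℝ) (β : ℝ) : ℕ :=
  sInf {k | HasFactorization B β k}

/-- The inputs of the algorithm: initial model set, policy class, number of trajectories per round,
exploration tolerance, elimination threshold, and the test functions used to compute the empirical
misfits. -/
structure Inputs (S A : Type*) [MeasurableSpace S] [MeasurableSpace A] where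
  models : Set (Model S A)
  policies : Set (Policy S A)
  n : ℕ
  ε : ℝ
  φ : ℝ
  tests : Set ((S × A) × S → ℝ)

/-- The choices and observations made along an execution, with rounds numbered `0, 1, 2, …`: the
exploration policy of round `t`, and the transitions `((s_{h-1}, a_{h-1}), s_h)`, for each time step
`h`, of the dataset collected in round `t`. The entries after the round in which the algorithm
halts are never used. -/
structure Trace {S A : Type*} [MeasurableSpace S] [MeasurableSpace A] (I : Inputs S A) where
  policy : ℕ → Policy S A
  data : ℕ → ℕ → Fin I.n → (S × A) × S

section

variable {S A : Type*} [MeasurableSpace S] [MeasurableSpace A]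

/-- The empirical misfit of `M` at time step `h` from the data collected in round `t`. -/
def Trace.empMisfit {I : Inputs S A} (R : Trace I) (t : ℕ) (M : Model S A) (h : ℕ) : ℝ :=
  empiricalMisfit I.tests (R.data t h) M

/-- The set of models at the beginning of round `t`: each round keeps the models whose empirical
misfit is at most `φ` at every time step. -/
def Trace.modelSet (E : Env S A) {I : Inputs S A} (R : Trace I) : ℕ → Set (Model S A)
  | 0 => I.models
  | t + 1 => {M ∈ R.modelSet E t | ∀ h ∈ Finset.Icc 1 E.horizon, R.empMisfit t M h ≤ I.φ}

variable [Fintype A] [Nonempty A]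

/-- The test in round `t` is passed, so that the algorithm explores (and updates the model set)
instead of halting. -/
def Trace.Explores (E : Env S A) {I : Inputs S A} (R : Trace I) (t : ℕ) : Prop :=
  ENNReal.ofReal (I.ε / Fintype.card A) < vExplore E (R.policy t) (R.modelSet E t)

/-- Round `t` is executed: the algorithm did not halt in an earlier round. -/
def Trace.Reaches (E : Env S A) {I : Inputs S A} (R : Trace I) (t : ℕ) : Prop :=
  ∀ r < t, R.Explores E r

/-- The trace is an execution of the algorithm: in every executed round the exploration policy is an
exact maximizer of the exploration value over the policy class. -/
def Trace.IsExecution (E : Env S A) {I : Inputs S A} (R : Trace I) : Prop :=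
  ∀ t, R.Reaches E t → R.policy t ∈ I.policies ∧
    ∀ π ∈ I.policies, vExplore E π (R.modelSet E t) ≤ vExplore E (R.policy t) (R.modelSet E t)

/-- All empirical misfits computed during the execution are within `φ` of the true ones. -/
def Trace.Accurate (E : Env S A) {I : Inputs S A} (R : Trace I) : Prop :=
  ∀ t, R.Reaches E t → R.Explores E t → ∀ h ∈ Finset.Icc 1 E.horizon, ∀ M ∈ I.models,
    |R.empMisfit t M h - misfit E (R.policy t) M h| ≤ I.φ

/-- The algorithm halts, and it does so in its `N`-th round (so `N - 1` rounds of exploration are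
followed by the round in which it halts). -/
def Trace.HaltsWithRounds (E : Env S A) {I : Inputs S A} (R : Trace I) (N : ℕ) : Prop :=
  ∃ t, N = t + 1 ∧ R.Reaches E t ∧ ¬ R.Explores E t

end

end DREEM

end

/-! Every exploring round `t` exposes a model `M t` that survived all earlier rounds but has misfit
above `12 √d φ` at some time step (`exists_misfit_gt`). This is a simulation argument: disagreement
with the truth telescopes into one-step misfits, and replacing the policy's action by a uniform one
costs a factor `|A|`. Accuracy forces the survivor's misfit to be at most `2 φ` under the policies
of all earlier rounds.

Fix a time step and factor the misfit matrix. The policy vectors `u i` and model vectors `w j`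
satisfy `|⟨u i, w j⟩| ≤ 2 φ` for `i < j` and `|⟨u i, w i⟩| > 12 √k φ`. An ellipsoid argument bounds
the number of such pairs (`card_mul_log_three_le`): cutting `{v | vᵀ L v ≤ 1}` with each new slab
multiplies `det L` by at least 9 while `trace L` stays at most `β² / (4 φ²)`, and `det L ≤ (trace L)
^ k`.

Summing over time steps gives `T log 3 ≤ H d log (β / (2 φ))` for `T` exploring rounds. Since `2 log
(5/3) ≤ log 3`, half of the claimed bound pays for these rounds and the other half for the halting
round. -/

namespace DREEM

/-! ### Ellipsoid potential argument -/

section Ellipsoid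

open Matrix

theorem det_le_trace_pow {k : ℕ} {L : Matrix (Fin k) (Fin k) ℝ} (hL : L.PosSemidef) :
    L.det ≤ L.trace ^ k := by
  have hdet := hL.1.det_eq_prod_eigenvalues
  have htr := hL.1.trace_eq_sum_eigenvalues
  simp only [RCLike.ofReal_real_eq_id, id_eq] at hdet htr
  calc L.det = ∏ i, hL.1.eigenvalues i := hdet
    _ ≤ ∏ _i : Fin k, L.trace := by
        refine Finset.prod_le_prod (fun i _ => hL.eigenvalues_nonneg i) fun i _ => ?_
        rw [htr]
        exact Finset.single_le_sum (fun j _ => hL.eigenvalues_nonneg j) (Finset.mem_univ i)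
    _ = L.trace ^ k := by simp

theorem det_add_smul_vecMulVec {k : ℕ} {L : Matrix (Fin k) (Fin k) ℝ} (hL : L.PosDef)
    (c : ℝ) (u : Fin k → ℝ) :
    (L + c • vecMulVec u u).det = L.det * (1 + c * (u ⬝ᵥ (L⁻¹ *ᵥ u))) := by
  have h := det_add_replicateCol_mul_replicateRow (ι := Unit) (A := L) hL.det_pos.ne'.isUnit
    (c • u) u
  rw [← vecMulVec_eq, smul_vecMulVec] at h
  rw [h]
  congr 1
  rw [det_unique, Matrix.add_apply, one_apply_eq, Matrix.mul_assoc, ← replicateCol_mulVec,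
    replicateRow_mul_replicateCol_apply, mulVec_smul, dotProduct_smul, smul_eq_mul]

/-- Cauchy–Schwarz for the form `L`, obtained from its nonnegativity at `v - c⁻¹ L⁻¹ u` with `c = u
⬝ᵥ v`. -/
theorem sq_dotProduct_le_of_quadForm_le_one {k : ℕ} {L : Matrix (Fin k) (Fin k) ℝ}
    (hL : L.PosDef) {u v : Fin k → ℝ} (hv : v ⬝ᵥ (L *ᵥ v) ≤ 1) (huv : u ⬝ᵥ v ≠ 0) :
    (u ⬝ᵥ v) ^ 2 ≤ u ⬝ᵥ (L⁻¹ *ᵥ u) := by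
  set c := u ⬝ᵥ v with hc
  set w := L⁻¹ *ᵥ u with hw
  have hLw : L *ᵥ w = u := by
    rw [hw, mulVec_mulVec, mul_nonsing_inv _ hL.det_pos.ne'.isUnit, one_mulVec]
  have hwL : w ⬝ᵥ (L *ᵥ v) = c := by
    have hT : Lᵀ = L := by
      rw [← conjTranspose_eq_transpose_of_trivial]; exact hL.1.eq
    rw [dotProduct_mulVec, ← mulVec_transpose, hT, hLw]
  have h := hL.posSemidef.dotProduct_mulVec_nonneg (v - c⁻¹ • w)
  have hst : star (v - c⁻¹ • w) = v - c⁻¹ • w := by ext; simp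
  rw [hst, mulVec_sub, mulVec_smul, hLw, sub_dotProduct, dotProduct_sub, dotProduct_sub,
    smul_dotProduct, smul_dotProduct, dotProduct_smul, dotProduct_smul, hwL, dotProduct_comm v u,
    dotProduct_comm w u, ← hc] at h
  simp only [smul_eq_mul, inv_mul_cancel₀ huv] at h
  have h1 : 1 ≤ c⁻¹ * (c⁻¹ * (u ⬝ᵥ w)) := by linarith
  have h2 : 0 < c ^ 2 := by positivity
  calc c ^ 2 = c ^ 2 * 1 := by ring
    _ ≤ c ^ 2 * (c⁻¹ * (c⁻¹ * (u ⬝ᵥ w))) := by gcongr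
    _ = u ⬝ᵥ w := by field_simp

/-- Holds because `(1 + 1/k) ^ k ≤ e < 37/9`. It bounds the determinant lost when the updated matrix
is rescaled by `k / (k + 1)`. -/
theorem nine_mul_succ_pow_le {k : ℕ} (hk : 0 < k) :
    9 * ((k : ℝ) + 1) ^ k ≤ 37 * (k : ℝ) ^ k := by
  have hk' : (0 : ℝ) < k := by exact_mod_cast hk
  have h1 : (1 + 1 / (k : ℝ)) ^ k ≤ Real.exp 1 := by
    calc (1 + 1 / (k : ℝ)) ^ k ≤ Real.exp (1 / k) ^ k := by
          gcongr
          linarith [Real.add_one_le_exp (1 / (k : ℝ))]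
      _ = Real.exp 1 := by
          rw [← Real.exp_nat_mul]; congr 1; field_simp
  have h2 : ((k : ℝ) + 1) ^ k = (k : ℝ) ^ k * (1 + 1 / (k : ℝ)) ^ k := by
    rw [← mul_pow]; congr 1; field_simp
  have h3 := Real.exp_one_lt_d9
  have h4 : 0 < (k : ℝ) ^ k := by positivity
  rw [h2]
  nlinarith

/-- One step of the ellipsoid method, for the ellipsoid `{v | vᵀ L v ≤ 1}` cut by the slab
`{v | |⟨u, v⟩| ≤ 2 φ}`. -/
theorem exists_ellipsoid_update {k : ℕ} (hk : 0 < k) {L : Matrix (Fin k) (Fin k) ℝ}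
    (hL : L.PosDef) {φ C : ℝ} (hφ : 0 < φ) {u w : Fin k → ℝ} (htr : L.trace ≤ C)
    (hu : u ⬝ᵥ u ≤ 4 * φ ^ 2 * C) (hw : w ⬝ᵥ (L *ᵥ w) ≤ 1)
    (huw : 12 * √k * φ < |u ⬝ᵥ w|) :
    ∃ L' : Matrix (Fin k) (Fin k) ℝ, L'.PosDef ∧ L'.trace ≤ C ∧ 9 * L.det ≤ L'.det ∧
      ∀ v, v ⬝ᵥ (L *ᵥ v) ≤ 1 → |u ⬝ᵥ v| ≤ 2 * φ → v ⬝ᵥ (L' *ᵥ v) ≤ 1 := by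
  have hk' : (0 : ℝ) < k := by exact_mod_cast hk
  have hq : 144 * k * φ ^ 2 ≤ u ⬝ᵥ (L⁻¹ *ᵥ u) := by
    have h0 : 0 ≤ 12 * √k * φ := by positivity
    refine le_trans ?_ (sq_dotProduct_le_of_quadForm_le_one hL hw
      (abs_pos.1 (h0.trans_lt huw)))
    rw [← sq_abs (u ⬝ᵥ w)]
    calc 144 * k * φ ^ 2 = (12 * √k * φ) ^ 2 := by
          rw [mul_pow, mul_pow, Real.sq_sqrt hk'.le]; norm_num
      _ ≤ _ := by gcongr
  -- On the slab `c (u ⬝ᵥ v)² ≤ 1/k`, and likewise `c (u ⬝ᵥ u) ≤ C/k`. The factor `a = 1 / (1 +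
  -- 1/k)` therefore restores both the level 1 and the trace bound `C`.
  set a : ℝ := k / (k + 1) with ha
  have ha0 : 0 < a := by positivity
  set c : ℝ := 1 / (4 * k * φ ^ 2) with hc
  have hc0 : 0 < c := by positivity
  have hac : a * c * (4 * φ ^ 2) = 1 - a := by rw [ha, hc]; field_simp; ring
  have hvv : (vecMulVec u u).PosSemidef := by
    simpa using posSemidef_vecMulVec_self_star u
  refine ⟨a • (L + c • vecMulVec u u),
    (hL.add_posSemidef (hvv.smul hc0.le)).smul ha0, ?_, ?_, ?_⟩
  · rw [trace_smul, trace_add, trace_smul, trace_vecMulVec, smul_eq_mul, smul_eq_mul]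
    calc a * (L.trace + c * (u ⬝ᵥ u)) ≤ a * (C + c * (4 * φ ^ 2 * C)) := by gcongr
      _ = a * C + a * c * (4 * φ ^ 2) * C := by ring
      _ = C := by rw [hac]; ring
  · rw [det_smul, det_add_smul_vecMulVec hL, Fintype.card_fin]
    have h1 : 37 ≤ 1 + c * (u ⬝ᵥ (L⁻¹ *ᵥ u)) := by
      have : c * (144 * k * φ ^ 2) = 36 := by rw [hc]; field_simp; norm_num
      have := mul_le_mul_of_nonneg_left hq hc0.le
      linarith
    have h2 : 9 ≤ a ^ k * 37 := by
      rw [ha, div_pow, div_mul_eq_mul_div, le_div_iff₀ (by positivity)]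
      linarith [nine_mul_succ_pow_le hk]
    have := hL.det_pos
    calc 9 * L.det ≤ (a ^ k * 37) * L.det := by gcongr
      _ = a ^ k * (L.det * 37) := by ring
      _ ≤ _ := by gcongr
  · intro v hv huv
    rw [smul_mulVec, add_mulVec, smul_mulVec, dotProduct_smul, dotProduct_add, dotProduct_smul,
      vecMulVec_mulVec]
    have h1 : (u ⬝ᵥ v) ^ 2 ≤ 4 * φ ^ 2 := by
      rw [← sq_abs (u ⬝ᵥ v)]
      calc |u ⬝ᵥ v| ^ 2 ≤ (2 * φ) ^ 2 := by gcongr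
        _ = _ := by ring
    have h2 : v ⬝ᵥ (MulOpposite.op (u ⬝ᵥ v) • u) = (u ⬝ᵥ v) ^ 2 := by
      rw [dotProduct_smul, dotProduct_comm v u]
      simp [sq]
    rw [h2, smul_eq_mul, smul_eq_mul]
    calc a * (v ⬝ᵥ (L *ᵥ v) + c * (u ⬝ᵥ v) ^ 2) ≤ a * (1 + c * (4 * φ ^ 2)) := by gcongr
      _ = a + a * c * (4 * φ ^ 2) := by ring
      _ = 1 := by rw [hac]; ring

theorem exists_ellipsoid {k : ℕ} (hk : 0 < k) {φ β : ℝ} (hφ : 0 < φ)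
    (hβ : 12 * √k * φ ≤ β) (u w : ℕ → Fin k → ℝ) (s : Finset ℕ)
    (hu : ∀ i ∈ s, u i ⬝ᵥ u i ≤ β ^ 2) (hw : ∀ i ∈ s, w i ⬝ᵥ w i ≤ 1)
    (hlt : ∀ i ∈ s, ∀ j ∈ s, i < j → |u i ⬝ᵥ w j| ≤ 2 * φ)
    (hdiag : ∀ i ∈ s, 12 * √k * φ < |u i ⬝ᵥ w i|) :
    ∃ L : Matrix (Fin k) (Fin k) ℝ, L.PosDef ∧ L.trace ≤ β ^ 2 / (4 * φ ^ 2) ∧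
      9 ^ s.card ≤ L.det ∧
      ∀ v, v ⬝ᵥ v ≤ 1 → (∀ i ∈ s, |u i ⬝ᵥ v| ≤ 2 * φ) → v ⬝ᵥ (L *ᵥ v) ≤ 1 := by
  -- Adding the largest index last puts `w a` in the slabs of all indices already treated, hence in
  -- the current ellipsoid, as the update requires.
  induction s using Finset.induction_on_max with
  | empty =>
    refine ⟨1, PosDef.one, ?_, by simp, by simp⟩
    rw [trace_one, Fintype.card_fin, le_div_iff₀ (by positivity)]
    have h1 : (12 * √k * φ) ^ 2 ≤ β ^ 2 := by gcongr
    rw [mul_pow, mul_pow, Real.sq_sqrt (Nat.cast_nonneg k)] at h1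
    have : (0 : ℝ) ≤ k * φ ^ 2 := by positivity
    linarith
  | insert a s hmax ih =>
    obtain ⟨L, hL, htr, hdet, hell⟩ := ih (fun i hi => hu i (Finset.mem_insert_of_mem hi))
      (fun i hi => hw i (Finset.mem_insert_of_mem hi))
      (fun i hi j hj => hlt i (Finset.mem_insert_of_mem hi) j (Finset.mem_insert_of_mem hj))
      (fun i hi => hdiag i (Finset.mem_insert_of_mem hi))
    have hmem := Finset.mem_insert_self a s
    have hna : a ∉ s := fun h => (hmax a h).false
    obtain ⟨L', hL', htr', hdet', hell'⟩ := exists_ellipsoid_update hk hL hφ htr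
      (u := u a) (w := w a)
      (by rw [mul_div_cancel₀ _ (by positivity)]; exact hu a hmem)
      (hell _ (hw a hmem) fun i hi =>
        hlt i (Finset.mem_insert_of_mem hi) a hmem (hmax i hi))
      (hdiag a hmem)
    refine ⟨L', hL', htr', ?_, fun v hv hs => hell' v
      (hell v hv fun i hi => hs i (Finset.mem_insert_of_mem hi)) (hs a hmem)⟩
    rw [Finset.card_insert_of_notMem hna, pow_succ]
    linarith

theorem card_mul_log_three_le_of_normalized {k : ℕ} (hk : 0 < k) {φ β : ℝ} (hφ : 0 < φ)
    (hβ : 12 * √k * φ ≤ β) (u w : ℕ → Fin k → ℝ) (s : Finset ℕ)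
    (hu : ∀ i ∈ s, u i ⬝ᵥ u i ≤ β ^ 2) (hw : ∀ i ∈ s, w i ⬝ᵥ w i ≤ 1)
    (hlt : ∀ i ∈ s, ∀ j ∈ s, i < j → |u i ⬝ᵥ w j| ≤ 2 * φ)
    (hdiag : ∀ i ∈ s, 12 * √k * φ < |u i ⬝ᵥ w i|) :
    s.card * Real.log 3 ≤ k * Real.log (β / (2 * φ)) := by
  have hk' : (0 : ℝ) < k := by exact_mod_cast hk
  have hβ0 : 0 < β := lt_of_lt_of_le (by positivity) hβ
  obtain ⟨L, hL, htr, hdet, -⟩ := exists_ellipsoid hk hφ hβ u w s hu hw hlt hdiag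
  have h1 : (9 : ℝ) ^ s.card ≤ (β ^ 2 / (4 * φ ^ 2)) ^ k :=
    hdet.trans <| (det_le_trace_pow hL.posSemidef).trans <|
      pow_le_pow_left₀ hL.posSemidef.trace_nonneg htr k
  have h2 := Real.log_le_log (by positivity) h1
  have h9 : (9 : ℝ) = 3 ^ 2 := by norm_num
  have hq : β ^ 2 / (4 * φ ^ 2) = (β / (2 * φ)) ^ 2 := by rw [div_pow]; ring
  rw [hq, h9, Real.log_pow, Real.log_pow, Real.log_pow, Real.log_pow] at h2
  push_cast at h2
  linarith

/-- The number of vectors that can be found to violate the slab constraints of all earlier ones by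
a factor of more than `6 √k`. -/
theorem card_mul_log_three_le {k : ℕ} {φ β : ℝ} (hφ : 0 < φ)
    (u w : ℕ → EuclideanSpace ℝ (Fin k)) (s : Finset ℕ) (hs : s.Nonempty)
    (huw : ∀ i ∈ s, ∀ j ∈ s, ‖u i‖ * ‖w j‖ ≤ β)
    (hlt : ∀ i ∈ s, ∀ j ∈ s, i < j → |inner ℝ (u i) (w j)| ≤ 2 * φ)
    (hdiag : ∀ i ∈ s, 12 * √k * φ < |inner ℝ (u i) (w i)|) :
    s.card * Real.log 3 ≤ k * Real.log (β / (2 * φ)) := by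
  obtain ⟨m, hm, hmax⟩ := s.exists_max_image (fun i => ‖w i‖) hs
  have hCS := fun i j => abs_real_inner_le_norm (u i) (w j)
  have hpos : 0 < |inner ℝ (u m) (w m)| := lt_of_le_of_lt (by positivity) (hdiag m hm)
  have hw0 : 0 < ‖w m‖ := by
    rw [norm_pos_iff]
    rintro h
    simp [h] at hpos
  have hk : 0 < k := by
    rcases Nat.eq_zero_or_pos k with rfl | h
    · exact absurd (Subsingleton.elim (w m) 0) (norm_pos_iff.1 hw0)
    · exact h
  -- Only the products `‖u i‖ * ‖w j‖` are bounded; moving the largest norm `b` from the `w` side to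
  -- the `u` side normalizes both without changing inner products.
  set b := ‖w m‖ with hb
  have hdot : ∀ x y : EuclideanSpace ℝ (Fin k), x.ofLp ⬝ᵥ y.ofLp = inner ℝ x y := by
    intro x y
    rw [EuclideanSpace.inner_eq_star_dotProduct, dotProduct_comm]
    simp
  have hsc : ∀ i j, (b • u i).ofLp ⬝ᵥ (b⁻¹ • w j).ofLp = inner ℝ (u i) (w j) := by
    intro i j
    rw [hdot, real_inner_smul_left, real_inner_smul_right, mul_inv_cancel_left₀ hw0.ne']
  refine card_mul_log_three_le_of_normalized hk hφ
    ((hdiag m hm).le.trans ((hCS m m).trans (huw m hm m hm)))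
    (fun i => (b • u i).ofLp) (fun i => (b⁻¹ • w i).ofLp) s ?_ ?_ ?_ ?_
  · intro i hi
    rw [hdot, real_inner_self_eq_norm_sq, norm_smul, Real.norm_of_nonneg hw0.le, mul_comm]
    gcongr
    exact huw i hi m hm
  · intro i hi
    rw [hdot, real_inner_self_eq_norm_sq, norm_smul, norm_inv, Real.norm_of_nonneg hw0.le]
    have := hmax i hi
    refine pow_le_one₀ (by positivity) ?_
    rw [inv_mul_le_iff₀ hw0, mul_one]
    exact this
  · intro i hi j hj hij
    rw [hsc]
    exact hlt i hi j hj hij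
  · intro i hi
    rw [hsc]
    exact hdiag i hi

end Ellipsoid

/-! ### Total variation by duality with test functions bounded by 1 -/

section TotalVariation

variable {X Y : Type*} [MeasurableSpace X] [MeasurableSpace Y]

theorem integrable_of_abs_le_one (μ : Measure X) [IsFiniteMeasure μ] {f : X → ℝ}
    (hf : Measurable f) (hf1 : ∀ x, |f x| ≤ 1) : Integrable f μ :=
  Integrable.of_bound hf.aestronglyMeasurable 1 (ae_of_all _ hf1)

theorem abs_integral_le_one (μ : Measure X) [IsProbabilityMeasure μ] {f : X → ℝ}
    (hf1 : ∀ x, |f x| ≤ 1) : |∫ x, f x ∂μ| ≤ 1 := by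
  have h := norm_integral_le_of_norm_le_const (μ := μ) (f := f) (C := 1) (ae_of_all _ hf1)
  simpa using h

/-- The Jordan decomposition of `μ - ν`, written additively so that only integrals against positive
measures are needed. -/
theorem exists_jordan_parts (μ ν : Measure X) [IsFiniteMeasure μ] [IsFiniteMeasure ν] :
    ∃ (p q : Measure X) (_ : IsFiniteMeasure p) (_ : IsFiniteMeasure q), p ⟂ₘ q ∧
      tvNorm μ ν = p Set.univ + q Set.univ ∧ μ + q = ν + p := by
  set s := μ.toSignedMeasure - ν.toSignedMeasure with hs
  refine ⟨s.toJordanDecomposition.posPart, s.toJordanDecomposition.negPart, inferInstance,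
    inferInstance, s.toJordanDecomposition.mutuallySingular, rfl, ?_⟩
  have h := s.toSignedMeasure_toJordanDecomposition
  rw [JordanDecomposition.toSignedMeasure] at h
  rw [← Measure.toSignedMeasure_eq_toSignedMeasure_iff, Measure.toSignedMeasure_add,
    Measure.toSignedMeasure_add]
  rw [sub_eq_iff_eq_add] at h
  rw [h, hs]
  abel

theorem integral_sub_integral_eq {μ ν p q : Measure X} [IsFiniteMeasure μ] [IsFiniteMeasure ν]
    [IsFiniteMeasure p] [IsFiniteMeasure q] (h : μ + q = ν + p) {f : X → ℝ}
    (hf : Measurable f) (hf1 : ∀ x, |f x| ≤ 1) :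
    ∫ x, f x ∂μ - ∫ x, f x ∂ν = ∫ x, f x ∂p - ∫ x, f x ∂q := by
  have hi := fun (m : Measure X) [IsFiniteMeasure m] => integrable_of_abs_le_one m hf hf1
  have h' : ∫ x, f x ∂(μ + q) = ∫ x, f x ∂(ν + p) := by rw [h]
  rw [integral_add_measure (hi μ) (hi q), integral_add_measure (hi ν) (hi p)] at h'
  linarith

theorem ofReal_integral_sub_le_tvNorm (μ ν : Measure X) [IsFiniteMeasure μ] [IsFiniteMeasure ν]
    {f : X → ℝ} (hf : Measurable f) (hf1 : ∀ x, |f x| ≤ 1) :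
    ENNReal.ofReal (∫ x, f x ∂μ - ∫ x, f x ∂ν) ≤ tvNorm μ ν := by
  obtain ⟨p, q, _, _, -, htv, hpq⟩ := exists_jordan_parts μ ν
  rw [htv, integral_sub_integral_eq hpq hf hf1]
  have hb : ∀ (m : Measure X) [IsFiniteMeasure m], |∫ x, f x ∂m| ≤ m.real Set.univ := by
    intro m _
    have h := norm_integral_le_of_norm_le_const (μ := m) (f := f) (C := 1) (ae_of_all _ hf1)
    simpa using h
  refine ENNReal.ofReal_le_of_le_toReal ?_
  rw [ENNReal.toReal_add (measure_ne_top _ _) (measure_ne_top _ _)]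
  have h1 := (abs_le.1 (hb p)).2
  have h2 := (abs_le.1 (hb q)).1
  simp only [measureReal_def] at h1 h2
  linarith

theorem exists_tvNorm_eq (μ ν : Measure X) [IsFiniteMeasure μ] [IsFiniteMeasure ν] :
    ∃ f : X → ℝ, Measurable f ∧ (∀ x, |f x| ≤ 1) ∧
      tvNorm μ ν = ENNReal.ofReal (∫ x, f x ∂μ - ∫ x, f x ∂ν) := by
  classical
  obtain ⟨p, q, _, _, ⟨i, hi, hpi, hqi⟩, htv, hpq⟩ := exists_jordan_parts μ ν
  -- The sign function of the Hahn decomposition: `i` is null for `p` and its complement is null for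
  -- `q`.
  have hf : Measurable (i.piecewise (fun _ => (-1 : ℝ)) fun _ => 1) :=
    measurable_const.piecewise hi measurable_const
  have hf1 : ∀ x, |i.piecewise (fun _ => (-1 : ℝ)) (fun _ => 1) x| ≤ 1 := by
    intro x
    by_cases hx : x ∈ i <;> simp [hx]
  refine ⟨_, hf, hf1, ?_⟩
  have hp : ∫ x, i.piecewise (fun _ => (-1 : ℝ)) (fun _ => 1) x ∂p = p.real Set.univ := by
    rw [integral_congr_ae (g := fun _ => (1 : ℝ))]
    · simp
    · have : ∀ᵐ x ∂p, x ∉ i := measure_eq_zero_iff_ae_notMem.1 hpi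
      filter_upwards [this] with x hx
      simp [hx]
  have hq : ∫ x, i.piecewise (fun _ => (-1 : ℝ)) (fun _ => 1) x ∂q = -q.real Set.univ := by
    rw [integral_congr_ae (g := fun _ => (-1 : ℝ))]
    · simp
    · have : ∀ᵐ x ∂q, x ∉ iᶜ := measure_eq_zero_iff_ae_notMem.1 hqi
      filter_upwards [this] with x hx
      rw [Set.notMem_compl_iff] at hx
      simp [hx]
  rw [integral_sub_integral_eq hpq hf hf1, hp, hq, sub_neg_eq_add,
    ENNReal.ofReal_add measureReal_nonneg measureReal_nonneg, ofReal_measureReal,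
    ofReal_measureReal, htv]

theorem tvNorm_self (μ : Measure X) [IsFiniteMeasure μ] : tvNorm μ μ = 0 := by
  obtain ⟨f, -, -, h⟩ := exists_tvNorm_eq μ μ
  simpa using h

theorem tvNorm_comm (μ ν : Measure X) [IsFiniteMeasure μ] [IsFiniteMeasure ν] :
    tvNorm μ ν = tvNorm ν μ := by
  rw [tvNorm, tvNorm, ← SignedMeasure.totalVariation_neg, neg_sub]

theorem tvNorm_triangle (μ ν ρ : Measure X) [IsFiniteMeasure μ] [IsFiniteMeasure ν]
    [IsFiniteMeasure ρ] : tvNorm μ ρ ≤ tvNorm μ ν + tvNorm ν ρ := by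
  obtain ⟨f, hf, hf1, h⟩ := exists_tvNorm_eq μ ρ
  rw [h]
  calc ENNReal.ofReal (∫ x, f x ∂μ - ∫ x, f x ∂ρ)
      = ENNReal.ofReal ((∫ x, f x ∂μ - ∫ x, f x ∂ν) + (∫ x, f x ∂ν - ∫ x, f x ∂ρ)) := by
        congr 1; ring
    _ ≤ _ := ENNReal.ofReal_add_le
    _ ≤ _ := add_le_add (ofReal_integral_sub_le_tvNorm μ ν hf hf1)
        (ofReal_integral_sub_le_tvNorm ν ρ hf hf1)

theorem tvNorm_le_two (μ ν : Measure X) [IsProbabilityMeasure μ] [IsProbabilityMeasure ν] :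
    tvNorm μ ν ≤ 2 := by
  obtain ⟨f, -, hf1, h⟩ := exists_tvNorm_eq μ ν
  rw [h, ← ENNReal.ofReal_ofNat 2]
  apply ENNReal.ofReal_le_ofReal
  linarith [(abs_le.1 (abs_integral_le_one μ hf1)).2, (abs_le.1 (abs_integral_le_one ν hf1)).1]

theorem integral_comp_measure (μ : Measure X) [IsFiniteMeasure μ] (κ : Kernel X Y)
    [IsMarkovKernel κ] {f : Y → ℝ} (hf : Measurable f) (hf1 : ∀ y, |f y| ≤ 1) :
    ∫ y, f y ∂(μ.bind κ) = ∫ x, ∫ y, f y ∂(κ x) ∂μ := by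
  have h := Kernel.integral_comp (η := κ) (κ := Kernel.const Unit μ) (a := ()) (f := f)
    (integrable_of_abs_le_one _ hf hf1)
  rwa [Kernel.comp_apply, Kernel.const_apply] at h

/-- Markov kernels do not increase the total variation distance. -/
theorem tvNorm_bind_le (μ ν : Measure X) [IsFiniteMeasure μ] [IsFiniteMeasure ν]
    (κ : Kernel X Y) [IsMarkovKernel κ] : tvNorm (μ.bind κ) (ν.bind κ) ≤ tvNorm μ ν := by
  obtain ⟨f, hf, hf1, h⟩ := exists_tvNorm_eq (μ.bind κ) (ν.bind κ)
  rw [h, integral_comp_measure μ κ hf hf1, integral_comp_measure ν κ hf hf1]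
  -- Averaging a test function over `κ` gives a test function with the same bound.
  exact ofReal_integral_sub_le_tvNorm μ ν hf.stronglyMeasurable.integral_kernel.measurable
    fun x => abs_integral_le_one (κ x) hf1

theorem tvNorm_compProd_left_le (μ ν : Measure X) [IsFiniteMeasure μ] [IsFiniteMeasure ν]
    (κ : Kernel X Y) [IsMarkovKernel κ] : tvNorm (μ ⊗ₘ κ) (ν ⊗ₘ κ) ≤ tvNorm μ ν := by
  simp only [Measure.compProd_eq_comp_prod]
  exact tvNorm_bind_le μ ν _

/-- The integral on the right is a lower integral: the integrand need not be measurable. -/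
theorem tvNorm_compProd_right_le (μ : Measure X) [IsFiniteMeasure μ] (κ η : Kernel X Y)
    [IsMarkovKernel κ] [IsMarkovKernel η] :
    tvNorm (μ ⊗ₘ κ) (μ ⊗ₘ η) ≤ ∫⁻ x, tvNorm (κ x) (η x) ∂μ := by
  obtain ⟨f, hf, hf1, h⟩ := exists_tvNorm_eq (μ ⊗ₘ κ) (μ ⊗ₘ η)
  have hi := fun (m : Measure (X × Y)) [IsFiniteMeasure m] => integrable_of_abs_le_one m hf hf1
  have hg : ∀ (ξ : Kernel X Y) [IsMarkovKernel ξ], Integrable (fun x => ∫ y, f (x, y) ∂ξ x) μ :=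
    fun ξ _ => integrable_of_abs_le_one μ
      hf.stronglyMeasurable.integral_kernel_prod_right'.measurable
      fun x => abs_integral_le_one (ξ x) fun y => hf1 (x, y)
  rw [h, Measure.integral_compProd (hi _), Measure.integral_compProd (hi _),
    ← integral_sub (hg κ) (hg η)]
  calc ENNReal.ofReal (∫ x, (∫ y, f (x, y) ∂κ x) - ∫ y, f (x, y) ∂η x ∂μ)
      ≤ ∫⁻ x, ENNReal.ofReal ((∫ y, f (x, y) ∂κ x) - ∫ y, f (x, y) ∂η x) ∂μ := by
        rw [integral_eq_lintegral_pos_part_sub_lintegral_neg_part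
          (f := fun x => (∫ y, f (x, y) ∂κ x) - ∫ y, f (x, y) ∂η x) ((hg κ).sub (hg η))]
        refine ENNReal.ofReal_le_of_le_toReal ?_
        simp
    _ ≤ ∫⁻ x, tvNorm (κ x) (η x) ∂μ := lintegral_mono fun x =>
        ofReal_integral_sub_le_tvNorm _ _ (hf.comp measurable_prodMk_left) fun y => hf1 (x, y)

theorem tvNorm_bind_right_le (μ : Measure X) [IsFiniteMeasure μ] (κ η : Kernel X Y)
    [IsMarkovKernel κ] [IsMarkovKernel η] :
    tvNorm (μ.bind κ) (μ.bind η) ≤ ∫⁻ x, tvNorm (κ x) (η x) ∂μ := by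
  refine le_trans ?_ (tvNorm_compProd_right_le μ κ η)
  have h := tvNorm_bind_le (μ ⊗ₘ κ) (μ ⊗ₘ η) (Kernel.deterministic Prod.snd measurable_snd)
  simp only [Measure.deterministic_comp_eq_map] at h
  simpa only [← Measure.snd_compProd, Measure.snd] using h

end TotalVariation

/-! ### Simulation: disagreement controlled by misfit -/

section Disagreement

variable {S A : Type*} [MeasurableSpace S] [MeasurableSpace A] [Fintype A]
  [Nonempty A]

/-- Nonempty measurable sets have uniform mass at least `1 / |A|`. This is the importance-weighting
cost of exchanging a policy's action for a uniform one. -/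
theorem measure_le_card_smul_uniform (ν : Measure A) [IsProbabilityMeasure ν] :
    ν ≤ (Fintype.card A : ℝ≥0∞) • (PMF.uniformOfFintype A).toMeasure := by
  classical
  refine Measure.le_iff.2 fun s hs => ?_
  rw [Measure.smul_apply, smul_eq_mul, PMF.toMeasure_uniformOfFintype_apply s hs]
  rw [ENNReal.mul_div_cancel (by simp) (by simp)]
  rcases s.eq_empty_or_nonempty with rfl | ⟨a, ha⟩
  · simp
  · refine prob_le_one.trans ?_
    have : Nonempty s := ⟨⟨a, ha⟩⟩
    exact_mod_cast Fintype.card_pos (α := s)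

theorem compProd_le_card_smul_prod_uniform (μ : Measure S) [IsFiniteMeasure μ] (π : Kernel S A)
    [IsMarkovKernel π] :
    μ ⊗ₘ π ≤ (Fintype.card A : ℝ≥0∞) • μ.prod (PMF.uniformOfFintype A).toMeasure := by
  refine Measure.le_iff.2 fun s hs => ?_
  rw [Measure.smul_apply, Measure.compProd_apply hs, Measure.prod_apply hs, smul_eq_mul,
    ← lintegral_const_mul _ (measurable_measure_prodMk_left hs)]
  exact lintegral_mono fun x => measure_le_card_smul_uniform (π x) _

theorem ofReal_misfit (E : Env S A) (π : Policy S A) (M : Model S A) (h : ℕ) :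
    ENNReal.ofReal (misfit E π M h) =
      ∫⁻ x, tvNorm (M.kernel x) (E.truth.kernel x) ∂(rollIn E E.truth π h) := by
  refine ENNReal.ofReal_toReal (ne_top_of_le_ne_top (b := 2) (by simp) ?_)
  calc _ ≤ ∫⁻ _, 2 ∂(rollIn E E.truth π h) := lintegral_mono fun x => tvNorm_le_two _ _
    _ = 2 := by simp

theorem tvNorm_stateDist_le (E : Env S A) (π : Policy S A) (M : Model S A) (h : ℕ) :
    tvNorm (stateDist E M π h) (stateDist E E.truth π h) ≤
      Fintype.card A * ∑ k ∈ Finset.Icc 1 h, ENNReal.ofReal (misfit E π M k) := by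
  induction h with
  | zero =>
    have : tvNorm (stateDist E M π 0) (stateDist E E.truth π 0) = 0 := tvNorm_self E.init
    simp [this]
  | succ h ih =>
    rw [Finset.sum_Icc_succ_top (by omega), mul_add]
    -- The hybrid follows the truth for `h` steps and `M` for the last one, so the new error is the
    -- misfit at `h + 1`.
    refine (tvNorm_triangle _ ((stateDist E E.truth π h ⊗ₘ π.kernel h).bind M.kernel) _).trans
      (add_le_add ?_ ?_)
    · exact (tvNorm_bind_le _ _ _).trans ((tvNorm_compProd_left_le _ _ _).trans ih)
    · refine (tvNorm_bind_right_le _ _ _).trans ?_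
      refine (lintegral_mono' (compProd_le_card_smul_prod_uniform _ _) le_rfl).trans ?_
      rw [lintegral_smul_measure, ofReal_misfit, smul_eq_mul]
      rfl

theorem disagreement_le (E : Env S A) (π : Policy S A) (M : Model S A) {h : ℕ} (hh : 1 ≤ h) :
    disagreement E π M E.truth h ≤
      Fintype.card A * ∑ k ∈ Finset.Icc 1 h, ENNReal.ofReal (misfit E π M k) := by
  obtain ⟨h, rfl⟩ : ∃ m, h = m + 1 := ⟨h - 1, by omega⟩
  rw [Finset.sum_Icc_succ_top (by omega), mul_add]
  refine (tvNorm_triangle _ (rollIn E E.truth π (h + 1) ⊗ₘ M.kernel) _).trans (add_le_add ?_ ?_)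
  · refine (tvNorm_compProd_left_le _ _ _).trans (le_trans ?_ (tvNorm_stateDist_le E π M h))
    have := tvNorm_compProd_left_le (stateDist E M π h) (stateDist E E.truth π h)
      (Kernel.const S (PMF.uniformOfFintype A).toMeasure)
    simp only [Measure.compProd_const] at this
    exact this
  · refine (tvNorm_compProd_right_le _ _ _).trans ?_
    rw [ofReal_misfit]
    refine le_mul_of_one_le_left' ?_
    exact_mod_cast Fintype.card_pos (α := A)

theorem disagreement_comm (E : Env S A) (π : Policy S A) (M M' : Model S A) (h : ℕ) :
    disagreement E π M M' h = disagreement E π M' M h :=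
  tvNorm_comm _ _

theorem sum_disagreement_le (E : Env S A) (π : Policy S A) (M : Model S A) :
    ∑ h ∈ Finset.Icc 1 E.horizon, disagreement E π M E.truth h ≤
      E.horizon * (Fintype.card A *
        ∑ k ∈ Finset.Icc 1 E.horizon, ENNReal.ofReal (misfit E π M k)) := by
  calc _ ≤ ∑ _h ∈ Finset.Icc 1 E.horizon, ((Fintype.card A : ℝ≥0∞) *
        ∑ k ∈ Finset.Icc 1 E.horizon, ENNReal.ofReal (misfit E π M k)) := by
        refine Finset.sum_le_sum fun h hh => ?_
        rw [Finset.mem_Icc] at hh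
        refine (disagreement_le E π M hh.1).trans ?_
        gcongr
        exact hh.2
    _ = _ := by simp

theorem misfit_nonneg (E : Env S A) (π : Policy S A) (M : Model S A) (h : ℕ) :
    0 ≤ misfit E π M h := ENNReal.toReal_nonneg

/-- If the exploration value is large, then some model has large misfit at some time step. -/
theorem exists_misfit_gt (E : Env S A) (π : Policy S A) (𝓜 : Set (Model S A)) {ε : ℝ}
    (hv : ENNReal.ofReal (ε / Fintype.card A) < vExplore E π 𝓜) :
    ∃ M ∈ 𝓜, ∃ h ∈ Finset.Icc 1 E.horizon,
      ε / (2 * (E.horizon : ℝ) ^ 2 * (Fintype.card A : ℝ) ^ 2) < misfit E π M h := by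
  by_contra! hcon
  refine hv.not_ge (iSup₂_le fun M hM => iSup₂_le fun M' hM' => ?_)
  have hA : (0 : ℝ) < Fintype.card A := by exact_mod_cast Fintype.card_pos (α := A)
  -- Half the tolerance for each model, because two models are compared through the truth.
  have hbound : ∀ N ∈ 𝓜, ∑ h ∈ Finset.Icc 1 E.horizon, disagreement E π N E.truth h ≤
      ENNReal.ofReal (ε / Fintype.card A / 2) := by
    intro N hN
    refine (sum_disagreement_le E π N).trans ?_
    rw [← ENNReal.ofReal_sum_of_nonneg fun k _ => misfit_nonneg E π N k,
      ← ENNReal.ofReal_natCast, ← ENNReal.ofReal_natCast, ← ENNReal.ofReal_mul (by positivity),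
      ← ENNReal.ofReal_mul (by positivity)]
    rcases Nat.eq_zero_or_pos E.horizon with h0 | hpos
    · simp [h0]
    apply ENNReal.ofReal_le_ofReal
    have hH : (0 : ℝ) < E.horizon := by exact_mod_cast hpos
    have hsum := Finset.sum_le_sum (hcon N hN)
    rw [Finset.sum_const, Nat.card_Icc, Nat.add_sub_cancel, nsmul_eq_mul] at hsum
    calc (E.horizon : ℝ) * (Fintype.card A * ∑ k ∈ Finset.Icc 1 E.horizon, misfit E π N k)
        ≤ E.horizon * (Fintype.card A * (E.horizon *
          (ε / (2 * (E.horizon : ℝ) ^ 2 * (Fintype.card A : ℝ) ^ 2)))) := by gcongr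
      _ = ε / Fintype.card A / 2 := by field_simp
  calc ∑ h ∈ Finset.Icc 1 E.horizon, disagreement E π M M' h
      ≤ ∑ h ∈ Finset.Icc 1 E.horizon,
          (disagreement E π M E.truth h + disagreement E π M' E.truth h) := by
        refine Finset.sum_le_sum fun h _ => ?_
        rw [disagreement_comm E π M']
        exact tvNorm_triangle _ _ _
    _ ≤ ENNReal.ofReal (ε / Fintype.card A / 2) + ENNReal.ofReal (ε / Fintype.card A / 2) := by
        rw [Finset.sum_add_distrib]
        exact add_le_add (hbound M hM) (hbound M' hM')
    _ = ENNReal.ofReal (ε / Fintype.card A) := by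
        rcases le_total 0 ε with h | h
        · rw [← ENNReal.ofReal_add (by positivity) (by positivity), add_halves]
        · have h1 : ε / Fintype.card A ≤ 0 := div_nonpos_of_nonpos_of_nonneg h hA.le
          rw [ENNReal.ofReal_of_nonpos h1, ENNReal.ofReal_of_nonpos (by linarith), add_zero]

end Disagreement

/-! ### Surviving models and the count of rounds -/

variable {S A : Type*} [MeasurableSpace S] [MeasurableSpace A]

theorem Trace.modelSet_antitone (E : Env S A) {I : Inputs S A} (R : Trace I) :
    Antitone (R.modelSet E) :=
  antitone_nat_of_succ_le fun _ _ hM => hM.1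

theorem Trace.modelSet_subset (E : Env S A) {I : Inputs S A} (R : Trace I) (t : ℕ) :
    R.modelSet E t ⊆ I.models :=
  R.modelSet_antitone E t.zero_le

theorem hasFactorization_boundedRank {m n : Type*} {B : Matrix m n ℝ} {β : ℝ}
    (h : ∃ k, HasFactorization B β k) : HasFactorization B β (boundedRank B β) :=
  Nat.sInf_mem (s := {k | HasFactorization B β k}) h

variable [Fintype A] [Nonempty A]

theorem Trace.Reaches.mono {E : Env S A} {I : Inputs S A} {R : Trace I} {r t : ℕ}
    (h : R.Reaches E t) (hrt : r ≤ t) : R.Reaches E r :=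
  fun _ hq => h _ (hq.trans_le hrt)

theorem Trace.misfit_le_of_mem_modelSet {E : Env S A} {I : Inputs S A} {R : Trace I}
    (hacc : R.Accurate E) {r t : ℕ} (ht : R.Reaches E t) (hrt : r < t) {M : Model S A}
    (hM : M ∈ R.modelSet E t) {h : ℕ} (hh : h ∈ Finset.Icc 1 E.horizon) :
    misfit E (R.policy r) M h ≤ 2 * I.φ := by
  have h1 := hacc r (ht.mono hrt.le) (ht r hrt) h hh M (R.modelSet_subset E t hM)
  have h2 : R.empMisfit r M h ≤ I.φ := (R.modelSet_antitone E hrt hM).2 h hh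
  linarith [(abs_le.1 h1).1]

/-- A bound on the number of exploring rounds in which the misfit at time step `h` is large. -/
theorem Trace.card_mul_log_three_le {E : Env S A} {I : Inputs S A} {R : Trace I}
    (hrun : R.IsExecution E) (hacc : R.Accurate E) {β : ℝ} {k d h T : ℕ}
    (hh : h ∈ Finset.Icc 1 E.horizon)
    (hfac : HasFactorization (misfitMatrix E I.policies I.models h) β k) (hkd : k ≤ d)
    (hφ : 0 < I.φ) (hT : R.Reaches E T) (M : ℕ → Model S A) (s : Finset ℕ) (hs : s.Nonempty)
    (hsT : ∀ t ∈ s, t < T) (hM : ∀ t ∈ s, M t ∈ R.modelSet E t)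
    (hbig : ∀ t ∈ s, 12 * √d * I.φ < misfit E (R.policy t) (M t) h) :
    s.card * Real.log 3 ≤ k * Real.log (β / (2 * I.φ)) := by
  classical
  obtain ⟨U, V, hUV, hnorm⟩ := hfac
  have hpol : ∀ t ∈ s, R.policy t ∈ I.policies := fun t ht =>
    (hrun t (hT.mono (hsT t ht).le)).1
  have hmod : ∀ t ∈ s, M t ∈ I.models := fun t ht => R.modelSet_subset E t (hM t ht)
  have hin : ∀ i (hi : i ∈ s) j (hj : j ∈ s),
      inner ℝ (U ⟨R.policy i, hpol i hi⟩) (V ⟨M j, hmod j hj⟩) = misfit E (R.policy i) (M j) h :=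
    fun i hi j hj => (hUV _ _).symm
  refine DREEM.card_mul_log_three_le hφ
    (fun t => if ht : t ∈ s then U ⟨R.policy t, hpol t ht⟩ else 0)
    (fun t => if ht : t ∈ s then V ⟨M t, hmod t ht⟩ else 0) s hs ?_ ?_ ?_
  · intro i hi j hj
    rw [dif_pos hi, dif_pos hj]
    exact hnorm _ _
  · intro i hi j hj hij
    rw [dif_pos hi, dif_pos hj, hin i hi j hj, abs_of_nonneg (misfit_nonneg _ _ _ _)]
    exact misfit_le_of_mem_modelSet hacc (hT.mono (hsT j hj).le) hij (hM j hj) hh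
  · intro i hi
    rw [dif_pos hi, dif_pos hi, hin i hi i hi, abs_of_nonneg (misfit_nonneg _ _ _ _)]
    refine lt_of_le_of_lt ?_ (hbig i hi)
    gcongr

theorem two_mul_log_five_thirds_le : 2 * Real.log (5 / 3) ≤ Real.log 3 := by
  rw [← Nat.cast_ofNat (n := 2), ← Real.log_pow]
  exact Real.log_le_log (by norm_num) (by norm_num)

/-- If the algorithm explores in `T ≥ 1` consecutive rounds, then `T + 1` is within the bound. -/
theorem Trace.succ_le_of_reaches {E : Env S A} {I : Inputs S A} {R : Trace I} (hε : 0 < I.ε)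
    {β : ℝ} {d : ℕ}
    (hβ : ∀ h ∈ Finset.Icc 1 E.horizon,
      ∃ k, HasFactorization (misfitMatrix E I.policies I.models h) β k)
    (hd : d = (Finset.Icc 1 E.horizon).sup fun h =>
      boundedRank (misfitMatrix E I.policies I.models h) β)
    (hφ : I.φ = I.ε / (24 * (E.horizon : ℝ) ^ 2 * (Fintype.card A : ℝ) ^ 2 * √(d : ℝ)))
    (hrun : R.IsExecution E) (hacc : R.Accurate E) {T : ℕ} (hT0 : 0 < T) (hT : R.Reaches E T) :
    (T : ℝ) + 1 ≤ (E.horizon : ℝ) * d * Real.log (β / (2 * I.φ)) / Real.log (5 / 3) := by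
  classical
  set δ : ℝ := I.ε / (2 * (E.horizon : ℝ) ^ 2 * (Fintype.card A : ℝ) ^ 2) with hδ
  have hwit : ∀ t : ℕ, ∃ (M : Model S A) (h : ℕ), t < T → M ∈ R.modelSet E t ∧
      h ∈ Finset.Icc 1 E.horizon ∧ δ < misfit E (R.policy t) M h := by
    intro t
    by_cases ht : t < T
    · obtain ⟨M, hM, h, hh, hgt⟩ := exists_misfit_gt E (R.policy t) _ (hT t ht)
      exact ⟨M, h, fun _ => ⟨hM, hh, hgt⟩⟩
    · exact ⟨E.truth, 0, fun h => absurd h ht⟩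
  choose M h hMh using hwit
  obtain ⟨hM0, hh0, hgt0⟩ := hMh 0 hT0
  have hHpos : 0 < E.horizon := by
    rw [Finset.mem_Icc] at hh0
    omega
  have hH : (1 : ℝ) ≤ E.horizon := by exact_mod_cast hHpos
  have hA : (0 : ℝ) < Fintype.card A := by exact_mod_cast Fintype.card_pos (α := A)
  have hδ0 : 0 < δ := by positivity
  have hrank : ∀ h ∈ Finset.Icc 1 E.horizon,
      boundedRank (misfitMatrix E I.policies I.models h) β ≤ d := fun h hh => by
    rw [hd]
    exact Finset.le_sup (f := fun h => boundedRank (misfitMatrix E I.policies I.models h) β) hh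
  obtain ⟨U, V, hUV, hnorm⟩ := hasFactorization_boundedRank (hβ _ hh0)
  have hUV0 := hUV ⟨R.policy 0, (hrun 0 (hT.mono hT0.le)).1⟩ ⟨M 0, R.modelSet_subset E 0 hM0⟩
  have hnorm0 := hnorm ⟨R.policy 0, (hrun 0 (hT.mono hT0.le)).1⟩
    ⟨M 0, R.modelSet_subset E 0 hM0⟩
  have hm0 : misfit E (R.policy 0) (M 0) (h 0) ≤ β := by
    refine le_trans (le_of_eq hUV0) ((real_inner_le_norm _ _).trans hnorm0)
  -- Rank 0 would make the misfit found in round 0 vanish, so `d = 0` excludes any exploring round.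
  -- This also keeps the division by `√d` in `φ` meaningful.
  have hd1 : 1 ≤ d := by
    refine le_trans (Nat.one_le_iff_ne_zero.2 fun hk => ?_) (hrank _ hh0)
    have hsub : Subsingleton (EuclideanSpace ℝ
        (Fin (boundedRank (misfitMatrix E I.policies I.models (h 0)) β))) := by
      rw [hk]; infer_instance
    rw [Subsingleton.elim (U _) 0, inner_zero_left] at hUV0
    have : misfit E (R.policy 0) (M 0) (h 0) = 0 := hUV0
    linarith
  have hd1' : (1 : ℝ) ≤ d := by exact_mod_cast hd1
  have hsq : 1 ≤ √(d : ℝ) := Real.one_le_sqrt.2 hd1'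
  have hφ0 : 0 < I.φ := by rw [hφ]; positivity
  have hδφ : 12 * √(d : ℝ) * I.φ = δ := by
    rw [hφ, hδ]; field_simp; norm_num
  -- From `12 √d φ = δ < misfit ≤ β`. It makes the logarithm at least `log 3`, which later pays for
  -- the halting round.
  have hβφ : 6 ≤ β / (2 * I.φ) := by
    rw [le_div_iff₀ (by positivity)]
    have : 1 * I.φ ≤ √(d : ℝ) * I.φ := by gcongr
    linarith
  set L := Real.log (β / (2 * I.φ)) with hL
  have hL3 : Real.log 3 ≤ L := Real.log_le_log (by norm_num) (by linarith)
  have hlog : 0 < Real.log (5 / 3) := Real.log_pos (by norm_num)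
  have h53 := two_mul_log_five_thirds_le
  have hstep : ∀ j ∈ Finset.Icc 1 E.horizon,
      (((Finset.range T).filter fun t => h t = j).card : ℝ) * Real.log 3 ≤ d * L := by
    intro j hj
    rcases ((Finset.range T).filter fun t => h t = j).eq_empty_or_nonempty with hs | hs
    · rw [hs]
      simp only [Finset.card_empty, Nat.cast_zero, zero_mul]
      have : 0 ≤ L := by linarith
      positivity
    · refine (card_mul_log_three_le hrun hacc hj (hasFactorization_boundedRank (hβ j hj))
        (hrank j hj) hφ0 hT M _ hs ?_ ?_ ?_).trans ?_
      · intro t ht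
        exact Finset.mem_range.1 (Finset.mem_filter.1 ht).1
      · intro t ht
        exact (hMh t (Finset.mem_range.1 (Finset.mem_filter.1 ht).1)).1
      · intro t ht
        obtain ⟨ht1, rfl⟩ := Finset.mem_filter.1 ht
        rw [hδφ]
        exact (hMh t (Finset.mem_range.1 ht1)).2.2
      · have h1 : (boundedRank (misfitMatrix E I.policies I.models j) β : ℝ) ≤ d := by
          exact_mod_cast hrank j hj
        have : 0 ≤ L := by linarith
        exact mul_le_mul_of_nonneg_right h1 this
  -- The exploring rounds are split according to the time step of their witness.
  have hcard : T = ∑ j ∈ Finset.Icc 1 E.horizon,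
      ((Finset.range T).filter fun t => h t = j).card := by
    rw [← Finset.card_eq_sum_card_fiberwise fun t ht =>
      (hMh t (Finset.mem_range.1 (Finset.mem_coe.1 ht))).2.1, Finset.card_range]
  have hTlog : (T : ℝ) * Real.log 3 ≤ E.horizon * d * L := by
    have hcard' : (T : ℝ) = ∑ j ∈ Finset.Icc 1 E.horizon,
        (((Finset.range T).filter fun t => h t = j).card : ℝ) := by exact_mod_cast hcard
    rw [hcard', Finset.sum_mul]
    refine (Finset.sum_le_sum hstep).trans (le_of_eq ?_)
    simp [mul_assoc]
  have hone : L ≤ E.horizon * d * L := by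
    have : 1 ≤ (E.horizon : ℝ) * d := one_le_mul_of_one_le_of_one_le hH hd1'
    exact le_mul_of_one_le_left (by linarith) this
  have hT2 : (T : ℝ) * (2 * Real.log (5 / 3)) ≤ T * Real.log 3 := by gcongr
  rw [le_div_iff₀ hlog]
  linarith

end DREEM

theorem lemma3 {S A : Type*} [MeasurableSpace S]
    [MeasurableSpace A] [MeasurableSingletonClass A] [Fintype A] [Nonempty A]
    (E : DREEM.Env S A) (I : DREEM.Inputs S A) (R : DREEM.Trace I)
    (htruth : E.truth ∈ I.models)
    (hε : 0 < I.ε)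
    -- `β` is such that `rank(A_h, β)` is defined for every `h`, and `d` is the largest of them
    (β : ℝ) (d : ℕ)
    (hβ : ∀ h ∈ Finset.Icc 1 E.horizon,
      ∃ k, DREEM.HasFactorization (DREEM.misfitMatrix E I.policies I.models h) β k)
    (hd : d = (Finset.Icc 1 E.horizon).sup fun h =>
      DREEM.boundedRank (DREEM.misfitMatrix E I.policies I.models h) β)
    (hφ : I.φ = I.ε / (24 * (E.horizon : ℝ) ^ 2 * (Fintype.card A : ℝ) ^ 2 * √(d : ℝ)))
    (hrun : R.IsExecution E)
    (hacc : R.Accurate E) :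
    ∃ N : ℕ, R.HaltsWithRounds E N ∧
      (N : ℝ) ≤ max 1
        ((E.horizon : ℝ) * d * Real.log (β / (2 * I.φ)) / Real.log (5 / 3)) := by
  classical
  have hbound := fun {T : ℕ} => DREEM.Trace.succ_le_of_reaches hε hβ hd hφ hrun hacc (T := T)
  have hhalt : ∃ t, ¬ R.Explores E t := by
    by_contra! hcon
    -- Perpetual exploration would make every positive `T` satisfy the same finite bound.
    obtain ⟨n, hn⟩ := exists_nat_gt
      ((E.horizon : ℝ) * d * Real.log (β / (2 * I.φ)) / Real.log (5 / 3))
    have := hbound n.succ_pos fun r _ => hcon r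
    push_cast at this
    linarith
  have hreach : R.Reaches E (Nat.find hhalt) := fun r hr => not_not.1 (Nat.find_min hhalt hr)
  refine ⟨Nat.find hhalt + 1, ⟨_, rfl, hreach, Nat.find_spec hhalt⟩, ?_⟩
  rcases Nat.eq_zero_or_pos (Nat.find hhalt) with h0 | hpos
  · simp [h0]
  · push_cast
    exact (hbound hpos hreach).trans (le_max_right _ _)
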